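/- Let $L$ be a compact Lie group and let $I$ be a set (finite or infinite). Write $\mathbb N^{(I)}$ for the finitely supported families of natural numbers indexed by $I$. Let $V=\bigoplus_{\underline n\in\mathbb N^{(I)}}V_{\underline n}$ be a multigraded complex representation of $L$: each $V_{\underline n}$ is an $L$-stable finite-dimensional subspace on which $L$ acts continuously, and $V_{\underline 0}=0$. Let $V_0$ (even) and $V_1$ (odd) be two copies of $V$, and let $$\mathbb K[V_0\oplus V_1]=S(V_0)\otimes\bigwedge V_1$$ be the super-symmetric algebra, with $L$ acting by algebra automorphisms that extend its action on $V_0$ and $V_1$. For $\underline n,\underline m\in\mathbb N^{(I)}$ and $p\in\mathbb Z/2$ let $\mathbb K_{\underline n,\underline m,p}$ be the span of the products $v_1\cdots v_a\otimes w_1\wedge\cdots\wedge w_b$ of homogeneous elements $v_i\in V_0$, $w_j\in V_1$ for which the degrees of the $v_i$ add up to $\underline n$, the degrees of the $w_j$ add up to $\underline m$, and the number $b$ of fermionic factors is congruent to $p$ modulo $2$. Put $\mathbb K^L_{\underline n,\underline m,p}=\mathbb K_{\underline n,\underline m,p}\cap\mathbb K[V_0\oplus V_1]^L$. Then all the spaces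 $\mathbb K^L_{\underline n,\underline m,p}$ are finite-dimensional, and the index of the invariant algebra $$\mathcal I(\mathbb K[V_0\oplus V_1]^L)=\sum_{\underline n,\underline m}\bigl(\dim\mathbb K^L_{\underline n,\underline m,0}-\dim\mathbb K^L_{\underline n,\underline m,1}\bigr)\,t^{\underline n}u^{\underline m}\in\mathbb Z[[t_i,u_i : i\in I]]$$ becomes $1$ after setting $t=u$ (that is, $u_i=t_i$ for all $i\in I$): $$\mathcal I(\mathbb K[V_0\oplus V_1]^L)\big|_{u=t}=1 .$$ -/

import Mathlib

open scoped TensorProduct ContDiff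

/-- The super-symmetric algebra `𝕂(V₀ ⊕ V₁) = S(V₀) ⊗ ⋀ V₁` of a complex superspace `V₀ ⊕ V₁`.
The factor `S(V₀)` is purely even, so that the graded tensor product of algebras is the
ordinary one. -/
abbrev SuperSym (V₀ V₁ : Type*) [AddCommGroup V₀] [Module ℂ V₀] [AddCommGroup V₁] [Module ℂ V₁] :=
  SymmetricAlgebra ℂ V₀ ⊗[ℂ] ExteriorAlgebra ℂ V₁

namespace SuperSym

section grading

variable {ι V₀ V₁ : Type*} [AddCommGroup V₀] [Module ℂ V₀] [AddCommGroup V₁] [Module ℂ V₁]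

/-- The piece of `𝕂(V₀ ⊕ V₁)` of bosonic multidegree `n`, fermionic multidegree `m` and parity `p`.
It is spanned by the products `v₁ ⋯ v_a ⊗ w₁ ∧ ⋯ ∧ w_b` of homogeneous elements where the degrees
of the `v`'s add up to `n`, those of the `w`'s add up to `m`, and the number `b` of fermionic
factors is congruent to `p` modulo 2. -/
noncomputable def component (𝒱₀ : (ι →₀ ℕ) → Submodule ℂ V₀) (𝒱₁ : (ι →₀ ℕ) → Submodule ℂ V₁)
    (n m : ι →₀ ℕ) (p : ZMod 2) : Submodule ℂ (SuperSym V₀ V₁) :=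
  Submodule.span ℂ
    {x | ∃ (a b : ℕ) (d : Fin a → ι →₀ ℕ) (e : Fin b → ι →₀ ℕ) (v : Fin a → V₀) (w : Fin b → V₁),
      (∀ r, v r ∈ 𝒱₀ (d r)) ∧ (∀ s, w s ∈ 𝒱₁ (e s)) ∧
      ∑ r, d r = n ∧ ∑ s, e s = m ∧ (b : ZMod 2) = p ∧
      x = (∏ r, SymmetricAlgebra.ι ℂ V₀ (v r)) ⊗ₜ[ℂ] ExteriorAlgebra.ιMulti ℂ b w}

end grading

section action

variable {L V : Type*} [Group L] [AddCommGroup V] [Module ℂ V]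

/-- The action of a group element on `𝕂(V ⊕ V)`, both copies of `V` carrying the representation
`ρ`, by algebra endomorphisms extending `ρ g` on the generators. -/
noncomputable def act (ρ : Representation ℂ L V) (g : L) : SuperSym V V →ₐ[ℂ] SuperSym V V :=
  Algebra.TensorProduct.map
    (SymmetricAlgebra.lift (SymmetricAlgebra.ι ℂ V ∘ₗ ρ g)) (ExteriorAlgebra.map (ρ g))

/-- The invariant algebra `𝕂(V ⊕ V)^L`. -/
noncomputable def invariants (ρ : Representation ℂ L V) : Subalgebra ℂ (SuperSym V V) :=
  ⨅ g : L, AlgHom.equalizer (act ρ g) (AlgHom.id ℂ (SuperSym V V))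

/-- The piece of `𝕂(V ⊕ V)^L` of bosonic multidegree `n`, fermionic multidegree `m` and
parity `p`. -/
noncomputable def invComponent {ι : Type*} (𝒱 : (ι →₀ ℕ) → Submodule ℂ V)
    (ρ : Representation ℂ L V) (n m : ι →₀ ℕ) (p : ZMod 2) : Submodule ℂ (SuperSym V V) :=
  component 𝒱 𝒱 n m p ⊓ Subalgebra.toSubmodule (invariants ρ)

end action

end SuperSym

/-- The index `∑_{n,m} (dim W_{n,m,even} - dim W_{n,m,odd}) t^n u^m` of a multigraded superspace.
The variables `t_i` are `X (Sum.inl i)` and the variables `u_i` are `X (Sum.inr i)`. -/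
noncomputable def superIndex {ι W : Type*} [AddCommGroup W] [Module ℂ W]
    (𝒲 : (ι →₀ ℕ) → (ι →₀ ℕ) → ZMod 2 → Submodule ℂ W) : MvPowerSeries (ι ⊕ ι) ℤ :=
  fun c ↦
    let n := (Finsupp.sumFinsuppEquivProdFinsupp c).1
    let m := (Finsupp.sumFinsuppEquivProdFinsupp c).2
    (Module.finrank ℂ (𝒲 n m 0) : ℤ) - (Module.finrank ℂ (𝒲 n m 1) : ℤ)

instance tendstoCofinite_sumElim_id (ι : Type*) :
    Filter.TendstoCofinite (Sum.elim id id : ι ⊕ ι → ι) := by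
  rw [Filter.tendstoCofinite_iff_finite_preimage_singleton]
  intro i
  refine ((Set.finite_singleton (Sum.inl i)).union (Set.finite_singleton (Sum.inr i))).subset ?_
  rintro (x | x) hx <;> simp_all

/-- The substitution `t = u`, sending both `t_i` and `u_i` to the same variable. -/
noncomputable def identifyVars (ι : Type*) : MvPowerSeries (ι ⊕ ι) ℤ →ₐ[ℤ] MvPowerSeries ι ℤ :=
  MvPowerSeries.rename (Sum.elim id id)

/-!
Let `D = d + δ` be the sum of the de Rham differential `v ↦ dv` and of the Koszul differential
`dv ↦ v`, that is, the odd derivation of `𝕂(V ⊕ V)` exchanging the two copies of `V`. It commutes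
with `L`, preserves the total multidegree `n + m` and reverses parity. Its square is an even
derivation which is the identity on generators, so it multiplies a product of `k` generators by `k`.
A product of total multidegree `N ≠ 0` has `k ≥ 1` factors, so `D²` and hence `D` are injective on
the elements of total multidegree `N`, and the invariants of total multidegree `N` have even and odd
parts of the same dimension. Setting `t = u` only retains the total multidegree, and in total
multidegree `0` there are just the constants, because `V` has no component of degree `0`.
-/

section SymmetricAlgebra

variable {R M A : Type*} [CommRing R] [AddCommGroup M] [Module R M] [Ring A] [Algebra R A]

open scoped IsMulCommutative in
/-- The extension to the symmetric algebra of a linear map into a possibly noncommutative algebra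
whose values commute pairwise. -/
noncomputable def symmetricAlgebraLiftOfCommute (f : M →ₗ[R] A)
    (hf : ∀ v w, Commute (f v) (f w)) : SymmetricAlgebra R M →ₐ[R] A :=
  letI S := Algebra.adjoin R (Set.range f)
  haveI : IsMulCommutative S :=
    Algebra.isMulCommutative_adjoin R (by rintro _ ⟨v, rfl⟩ _ ⟨w, rfl⟩; exact hf v w)
  S.val.comp <| SymmetricAlgebra.lift <|
    f.codRestrict S.toSubmodule fun v ↦ Algebra.subset_adjoin ⟨v, rfl⟩

theorem symmetricAlgebraLiftOfCommute_ι (f : M →ₗ[R] A) (hf : ∀ v w, Commute (f v) (f w)) (v : M) :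
    symmetricAlgebraLiftOfCommute f hf (SymmetricAlgebra.ι R M v) = f v := by
  simp only [symmetricAlgebraLiftOfCommute, AlgHom.comp_apply, SymmetricAlgebra.lift_ι_apply]
  rfl

end SymmetricAlgebra

section eigenspaces

variable {K W : Type*} [Field K] [AddCommGroup W] [Module K W] {κ τ : Type*}

theorem iSupIndep_of_le_eigenspace {U : κ → Submodule K W} {T : τ → Module.End K W} {χ : κ → τ → K}
    (hχ : Function.Injective χ) (hU : ∀ k t, U k ≤ (T t).eigenspace (χ k t)) : iSupIndep U := by
  classical
  rw [iSupIndep_iff_finsetSum_eq_zero_imp_eq_zero]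
  intro s
  induction s using Finset.induction_on with
  | empty => simp
  | insert j s hj ih =>
    intro v hv hsum
    have apply_eq (k) (hk : k ∈ insert j s) (t) : T t (v k) = χ k t • v k :=
      Module.End.mem_eigenspace_iff.mp (hU k t (hv k hk))
    have sum_smul_eq_zero (t) : ∑ k ∈ s, (χ k t - χ j t) • v k = 0 := by
      have h : ∑ k ∈ insert j s, (χ k t - χ j t) • v k = 0 := by
        simp only [sub_smul, Finset.sum_sub_distrib, ← Finset.smul_sum, hsum, smul_zero, sub_zero]
        rw [← Finset.sum_congr rfl fun k hk ↦ apply_eq k hk t, ← map_sum, hsum, map_zero]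
      simpa [Finset.sum_insert hj] using h
    have eq_zero (k) (hk : k ∈ s) : v k = 0 := by
      obtain ⟨t, ht⟩ := Function.ne_iff.mp (hχ.ne (ne_of_mem_of_not_mem hk hj))
      have := ih (fun k ↦ (χ k t - χ j t) • v k)
        (fun k hk ↦ (U k).smul_mem _ (hv k (Finset.mem_insert_of_mem hk))) (sum_smul_eq_zero t) k hk
      exact (smul_eq_zero.mp this).resolve_left (sub_ne_zero.mpr ht)
    rw [Finset.sum_insert hj, Finset.sum_eq_zero eq_zero, add_zero] at hsum
    exact (Finset.forall_mem_insert _ _ _).mpr ⟨hsum, eq_zero⟩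

theorem exists_end_le_eigenspace {𝒱 : κ → Submodule K W} (h : iSupIndep 𝒱) (c : κ → K) :
    ∃ T : Module.End K W, ∀ k, 𝒱 k ≤ T.eigenspace (c k) := by
  classical
  obtain ⟨P, hP⟩ := LinearMap.exists_leftInverse_of_injective _
    (LinearMap.ker_eq_bot.mpr h.dfinsupp_lsum_injective)
  refine ⟨DFinsupp.lsum ℕ (fun k ↦ c k • (𝒱 k).subtype) ∘ₗ P, fun k v hv ↦ ?_⟩
  have P_apply : P v = DFinsupp.single k ⟨v, hv⟩ := by
    simpa using LinearMap.congr_fun hP (DFinsupp.single k ⟨v, hv⟩)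
  simp [P_apply]

end eigenspaces

theorem finrank_iSup_of_iSupIndep {K W κ : Type*} [Field K] [AddCommGroup W] [Module K W]
    [Fintype κ] {U : κ → Submodule K W} (h : iSupIndep U) [∀ k, FiniteDimensional K (U k)] :
    Module.finrank K (⨆ k, U k : Submodule K W) = ∑ k, Module.finrank K (U k) := by
  classical
  rw [Submodule.iSup_eq_range_dfinsupp_lsum,
    LinearMap.finrank_range_of_inj h.dfinsupp_lsum_injective]
  exact Module.finrank_directSum K fun k ↦ U k

theorem iSup_inf_eqLocus_of_iSupIndep {R W κ τ : Type*} [Ring R] [AddCommGroup W] [Module R W]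
    {U : κ → Submodule R W} (h : iSupIndep U) {T : τ → Module.End R W}
    (hT : ∀ t k, U k ≤ (U k).comap (T t)) :
    (⨆ k, U k) ⊓ ⨅ t, LinearMap.eqLocus (T t) 1 = ⨆ k, U k ⊓ ⨅ t, LinearMap.eqLocus (T t) 1 := by
  refine le_antisymm (fun x ⟨hx, hx_fixed⟩ ↦ ?_) (iSup_le fun k ↦ inf_le_inf_right _ (le_iSup U k))
  obtain ⟨u, hu, rfl⟩ := (Submodule.mem_iSup_iff_exists_finsupp _ _).mp hx
  rw [SetLike.mem_coe, Submodule.mem_iInf] at hx_fixed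
  have component_fixed (t) (k) (hk : k ∈ u.support) : T t (u k) = u k := by
    refine (iSupIndep_iff_finsetSum_eq_imp_eq _).mp h u.support (fun k ↦ T t (u k)) u
      (fun k _ ↦ ⟨hT t k (hu k), hu k⟩) ?_ k hk
    rw [← map_sum]
    exact hx_fixed t
  exact sum_mem fun k hk ↦ Submodule.mem_iSup_of_mem k
    ⟨hu k, (Submodule.mem_iInf _).mpr fun t ↦ component_fixed t k hk⟩

theorem mapDomain_sumElim_id {ι M : Type*} [AddCommMonoid M] (c : ι ⊕ ι →₀ M) :
    c.mapDomain (Sum.elim id id) =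
      (Finsupp.sumFinsuppEquivProdFinsupp c).1 + (Finsupp.sumFinsuppEquivProdFinsupp c).2 := by
  classical
  induction c using Finsupp.induction_linear with
  | zero => ext; simp
  | add f g hf hg =>
    rw [Finsupp.mapDomain_add, hf, hg]
    ext
    simp only [Finsupp.add_apply, Finsupp.fst_sumFinsuppEquivProdFinsupp,
      Finsupp.snd_sumFinsuppEquivProdFinsupp]
    abel
  | single x k =>
    rw [Finsupp.mapDomain_single]
    ext i
    rcases x with x | x <;> simp [Finsupp.single_apply]

namespace SuperSym

section generators

variable {V₀ V₁ : Type*} [AddCommGroup V₀] [Module ℂ V₀] [AddCommGroup V₁] [Module ℂ V₁]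

/-- The inclusion of the even generators. -/
noncomputable def even : V₀ →ₗ[ℂ] SuperSym V₀ V₁ :=
  Algebra.TensorProduct.includeLeft.toLinearMap ∘ₗ SymmetricAlgebra.ι ℂ V₀

/-- The inclusion of the odd generators. -/
noncomputable def odd : V₁ →ₗ[ℂ] SuperSym V₀ V₁ :=
  Algebra.TensorProduct.includeRight.toLinearMap ∘ₗ ExteriorAlgebra.ι ℂ

theorem even_apply (v : V₀) :
    (even v : SuperSym V₀ V₁) = SymmetricAlgebra.ι ℂ V₀ v ⊗ₜ[ℂ] 1 := rfl

theorem odd_apply (w : V₁) :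
    (odd w : SuperSym V₀ V₁) = 1 ⊗ₜ[ℂ] ExteriorAlgebra.ι ℂ w := rfl

theorem even_mul_even (v v' : V₀) :
    (even v * even v' : SuperSym V₀ V₁) = even v' * even v := by
  simp [even_apply, mul_comm]

theorem even_mul_odd (v : V₀) (w : V₁) : (even v * odd w : SuperSym V₀ V₁) = odd w * even v := by
  simp [even_apply, odd_apply]

theorem odd_mul_self (w : V₁) : (odd w * odd w : SuperSym V₀ V₁) = 0 := by
  simp [odd_apply]

theorem odd_mul_odd (w w' : V₁) : (odd w * odd w' : SuperSym V₀ V₁) = -(odd w' * odd w) := by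
  have h : (odd (w + w') * odd (w + w') : SuperSym V₀ V₁) = 0 := odd_mul_self (w + w')
  simp only [map_add, add_mul, mul_add, odd_mul_self, zero_add, add_zero] at h
  exact eq_neg_of_add_eq_zero_right h

-- `TensorProduct.neg`, the negation found on `SuperSym V₀ V₁`, only unfolds to the one of the ring
-- structure in Mathlib's `neg_mul` and `mul_neg`, which therefore do not rewrite here.
protected theorem neg_mul (x y : SuperSym V₀ V₁) : -x * y = -(x * y) :=
  eq_neg_of_add_eq_zero_left (by rw [← add_mul, neg_add_cancel, zero_mul])

protected theorem mul_neg (x y : SuperSym V₀ V₁) : x * -y = -(x * y) :=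
  eq_neg_of_add_eq_zero_left (by rw [← mul_add, neg_add_cancel, mul_zero])

@[elab_as_elim]
theorem leftInduction {P : SuperSym V₀ V₁ → Prop} (one : P 1)
    (even_mul : ∀ v x, P x → P (even v * x)) (odd_mul : ∀ w x, P x → P (odd w * x))
    (add : ∀ x y, P x → P y → P (x + y)) (smul : ∀ (r : ℂ) x, P x → P (r • x))
    (x : SuperSym V₀ V₁) : P x := by
  have symmetric_mul (s : SymmetricAlgebra ℂ V₀) :
      ∀ x : SuperSym V₀ V₁, P x → P ((s ⊗ₜ 1) * x) := by
    induction s using SymmetricAlgebra.induction with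
    | algebraMap r =>
      intro x hx
      rw [← Algebra.TensorProduct.algebraMap_apply, ← Algebra.smul_def]
      exact smul r x hx
    | ι v => exact even_mul v
    | mul a b ha hb =>
      intro x hx
      rw [← mul_one (1 : ExteriorAlgebra ℂ V₁), ← Algebra.TensorProduct.tmul_mul_tmul, mul_assoc]
      exact ha _ (hb x hx)
    | add a b ha hb =>
      intro x hx
      rw [TensorProduct.add_tmul, add_mul]
      exact add _ _ (ha x hx) (hb x hx)
  have exterior_mul (y : ExteriorAlgebra ℂ V₁) :
      ∀ x : SuperSym V₀ V₁, P x → P ((1 ⊗ₜ y) * x) := by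
    induction y using ExteriorAlgebra.induction with
    | algebraMap r =>
      intro x hx
      rw [← Algebra.TensorProduct.algebraMap_apply', ← Algebra.smul_def]
      exact smul r x hx
    | ι w => exact odd_mul w
    | mul a b ha hb =>
      intro x hx
      rw [← mul_one (1 : SymmetricAlgebra ℂ V₀), ← Algebra.TensorProduct.tmul_mul_tmul, mul_assoc]
      exact ha _ (hb x hx)
    | add a b ha hb =>
      intro x hx
      rw [TensorProduct.tmul_add, add_mul]
      exact add _ _ (ha x hx) (hb x hx)
  induction x using TensorProduct.induction_on with
  | zero => simpa only [zero_smul] using smul 0 1 one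
  | add x y hx hy => exact add x y hx hy
  | tmul s y => simpa using symmetric_mul s _ (exterior_mul y 1 one)

variable {A : Type*} [Ring A] [Algebra ℂ A]

/-- The universal property of `𝕂(V₀ ⊕ V₁)`: the algebra homomorphism with prescribed values on the
generators, which have to satisfy the relations of the super-symmetric algebra. -/
noncomputable def lift (f : V₀ →ₗ[ℂ] A) (g : V₁ →ₗ[ℂ] A) (hf : ∀ v v', Commute (f v) (f v'))
    (hg : ∀ w, g w * g w = 0) (hfg : ∀ v w, Commute (f v) (g w)) : SuperSym V₀ V₁ →ₐ[ℂ] A :=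
  Algebra.TensorProduct.lift (symmetricAlgebraLiftOfCommute f hf) (ExteriorAlgebra.lift ℂ ⟨g, hg⟩)
    fun s y ↦ by
      induction s using SymmetricAlgebra.induction with
      | algebraMap r => rw [AlgHom.commutes]; exact Algebra.commute_algebraMap_left _ _
      | mul a b ha hb => rw [map_mul]; exact ha.mul_left hb
      | add a b ha hb => rw [map_add]; exact ha.add_left hb
      | ι v =>
        induction y using ExteriorAlgebra.induction with
        | algebraMap r => rw [AlgHom.commutes]; exact Algebra.commute_algebraMap_right _ _
        | mul a b ha hb => rw [map_mul]; exact ha.mul_right hb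
        | add a b ha hb => rw [map_add]; exact ha.add_right hb
        | ι w =>
          rw [symmetricAlgebraLiftOfCommute_ι, ExteriorAlgebra.lift_ι_apply]
          exact hfg v w

section lift

variable (f : V₀ →ₗ[ℂ] A) (g : V₁ →ₗ[ℂ] A) (hf : ∀ v v', Commute (f v) (f v'))
  (hg : ∀ w, g w * g w = 0) (hfg : ∀ v w, Commute (f v) (g w))

theorem lift_even (v : V₀) : lift f g hf hg hfg (even v) = f v := by
  simp [lift, even_apply, symmetricAlgebraLiftOfCommute_ι]

theorem lift_odd (w : V₁) : lift f g hf hg hfg (odd w) = g w := by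
  simp [lift, odd_apply]

end lift

variable {W₀ W₁ : Type*} [AddCommGroup W₀] [Module ℂ W₀] [AddCommGroup W₁] [Module ℂ W₁]

/-- The functoriality of `𝕂(V₀ ⊕ V₁)` in the two spaces of generators. -/
noncomputable def map (f₀ : V₀ →ₗ[ℂ] W₀) (f₁ : V₁ →ₗ[ℂ] W₁) :
    SuperSym V₀ V₁ →ₐ[ℂ] SuperSym W₀ W₁ :=
  Algebra.TensorProduct.map
    (SymmetricAlgebra.lift (SymmetricAlgebra.ι ℂ W₀ ∘ₗ f₀)) (ExteriorAlgebra.map f₁)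

theorem map_even (f₀ : V₀ →ₗ[ℂ] W₀) (f₁ : V₁ →ₗ[ℂ] W₁) (v : V₀) :
    map f₀ f₁ (even v) = even (f₀ v) := by
  simp [map, even_apply]

theorem map_odd (f₀ : V₀ →ₗ[ℂ] W₀) (f₁ : V₁ →ₗ[ℂ] W₁) (w : V₁) :
    map f₀ f₁ (odd w) = odd (f₁ w) := by
  simp [map, odd_apply]

end generators

section koszul

variable {V : Type*} [AddCommGroup V] [Module ℂ V]

/-- The value of `koszulHom` at an even generator. -/
noncomputable def evenMatrix : V →ₗ[ℂ] Matrix (Fin 2) (Fin 2) (SuperSym V V) where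
  toFun v := !![even v, odd v; 0, even v]
  map_add' v w := by simp
  map_smul' r v := by simp [Matrix.smul_of]

/-- The value of `koszulHom` at an odd generator. -/
noncomputable def oddMatrix : V →ₗ[ℂ] Matrix (Fin 2) (Fin 2) (SuperSym V V) where
  toFun w := !![-odd w, even w; 0, odd w]
  map_add' v w := by simp [add_comm]
  map_smul' r v := by simp [Matrix.smul_of]

theorem evenMatrix_apply (v : V) : evenMatrix v = !![even v, odd v; 0, even v] := rfl

theorem oddMatrix_apply (w : V) : oddMatrix w = !![-odd w, even w; 0, odd w] := rfl

theorem commute_evenMatrix (v v' : V) : Commute (evenMatrix v) (evenMatrix v') := by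
  simp [commute_iff_eq, evenMatrix_apply, even_mul_even v v', even_mul_odd, add_comm]

theorem oddMatrix_mul_self (w : V) : oddMatrix w * oddMatrix w = 0 := by
  ext i j
  fin_cases i <;> fin_cases j <;>
    simp [oddMatrix_apply, Matrix.mul_apply, even_mul_odd, odd_mul_self, SuperSym.neg_mul,
      SuperSym.mul_neg]

theorem commute_evenMatrix_oddMatrix (v w : V) : Commute (evenMatrix v) (oddMatrix w) := by
  simp [commute_iff_eq, evenMatrix_apply, oddMatrix_apply, even_mul_even v w, even_mul_odd,
    odd_mul_odd v w, SuperSym.neg_mul, SuperSym.mul_neg, add_comm]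

/-- The algebra homomorphism `x ↦ (σ x, D x; 0, x)`, where `σ` is the parity automorphism and `D`
is the Koszul derivation: multiplicativity of this matrix says that `D` is a `σ`-derivation. -/
noncomputable def koszulHom : SuperSym V V →ₐ[ℂ] Matrix (Fin 2) (Fin 2) (SuperSym V V) :=
  lift evenMatrix oddMatrix commute_evenMatrix oddMatrix_mul_self commute_evenMatrix_oddMatrix

theorem koszulHom_even (v : V) : koszulHom (even v) = evenMatrix v := lift_even ..

theorem koszulHom_odd (w : V) : koszulHom (odd w) = oddMatrix w := lift_odd ..

/-- The Koszul derivation, the odd derivation exchanging the two copies of `V`: the sum of the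
de Rham differential `v ↦ dv` and of the Koszul differential `dv ↦ v`. -/
noncomputable def koszul : Module.End ℂ (SuperSym V V) :=
  Matrix.entryLinearMap ℂ _ 0 1 ∘ₗ koszulHom.toLinearMap

theorem koszul_apply (x : SuperSym V V) : koszul x = koszulHom x 0 1 := rfl

theorem koszulHom_one_one (x : SuperSym V V) : koszulHom x 1 1 = x := by
  induction x using leftInduction with
  | one => simp
  | even_mul v x hx => simp [koszulHom_even, evenMatrix_apply, Matrix.mul_apply, hx]
  | odd_mul w x hx => simp [koszulHom_odd, oddMatrix_apply, Matrix.mul_apply, hx]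
  | add x y hx hy => simp [hx, hy]
  | smul r x hx => simp [hx]

theorem koszul_one : koszul (1 : SuperSym V V) = 0 := by
  simp [koszul_apply]

theorem koszul_even_mul (v : V) (x : SuperSym V V) :
    koszul (even v * x) = odd v * x + even v * koszul x := by
  simp [koszul_apply, koszulHom_even, evenMatrix_apply, Matrix.mul_apply, koszulHom_one_one,
    add_comm]

theorem koszul_odd_mul (w : V) (x : SuperSym V V) :
    koszul (odd w * x) = even w * x - odd w * koszul x := by
  simp [koszul_apply, koszulHom_odd, oddMatrix_apply, Matrix.mul_apply, koszulHom_one_one,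
    SuperSym.neg_mul, neg_add_eq_sub]

theorem koszul_koszul_even_mul (v : V) (x : SuperSym V V) :
    koszul (koszul (even v * x)) = even v * (x + koszul (koszul x)) := by
  rw [koszul_even_mul, map_add, koszul_odd_mul, koszul_even_mul, mul_add]
  abel

theorem koszul_koszul_odd_mul (w : V) (x : SuperSym V V) :
    koszul (koszul (odd w * x)) = odd w * (x + koszul (koszul x)) := by
  rw [koszul_odd_mul, map_sub, koszul_even_mul, koszul_odd_mul, mul_add]
  abel

theorem koszul_map {W : Type*} [AddCommGroup W] [Module ℂ W] (f : V →ₗ[ℂ] W) (x : SuperSym V V) :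
    koszul (map f f x) = map f f (koszul x) := by
  induction x using leftInduction with
  | one => simp only [map_one, koszul_one, map_zero]
  | even_mul v x hx =>
    simp only [map_mul, map_even, map_odd, koszul_even_mul, map_add, hx]
  | odd_mul w x hx =>
    simp only [map_mul, map_even, map_odd, koszul_odd_mul, map_sub, hx]
  | add x y hx hy => simp only [map_add, hx, hy]
  | smul r x hx => simp only [map_smul, hx]

end koszul

section component

variable {ι V₀ V₁ : Type*} [AddCommGroup V₀] [Module ℂ V₀] [AddCommGroup V₁] [Module ℂ V₁]
  {𝒱₀ : (ι →₀ ℕ) → Submodule ℂ V₀} {𝒱₁ : (ι →₀ ℕ) → Submodule ℂ V₁}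

theorem prod_ι_succ_tmul {a : ℕ} (v : Fin (a + 1) → V₀) (y : ExteriorAlgebra ℂ V₁) :
    (∏ r, SymmetricAlgebra.ι ℂ V₀ (v r)) ⊗ₜ[ℂ] y =
      even (v 0) * (∏ r : Fin a, SymmetricAlgebra.ι ℂ V₀ (v r.succ)) ⊗ₜ y := by
  rw [even_apply, Algebra.TensorProduct.tmul_mul_tmul, one_mul, Fin.prod_univ_succ]

theorem tmul_ιMulti_succ (s : SymmetricAlgebra ℂ V₀) {b : ℕ} (w : Fin (b + 1) → V₁) :
    s ⊗ₜ[ℂ] ExteriorAlgebra.ιMulti ℂ (b + 1) w =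
      odd (w 0) * s ⊗ₜ ExteriorAlgebra.ιMulti ℂ b fun r ↦ w r.succ := by
  rw [odd_apply, Algebra.TensorProduct.tmul_mul_tmul, one_mul, ExteriorAlgebra.ιMulti_succ_apply]
  rfl

theorem one_mem_component : (1 : SuperSym V₀ V₁) ∈ component 𝒱₀ 𝒱₁ 0 0 0 :=
  Submodule.subset_span ⟨0, 0, 0, 0, 0, 0, by simp [Algebra.TensorProduct.one_def]⟩

theorem even_mul_mem_component {d n m : ι →₀ ℕ} {p : ZMod 2} {v : V₀} {x : SuperSym V₀ V₁}
    (hv : v ∈ 𝒱₀ d) (hx : x ∈ component 𝒱₀ 𝒱₁ n m p) :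
    even v * x ∈ component 𝒱₀ 𝒱₁ (d + n) m p := by
  suffices component 𝒱₀ 𝒱₁ n m p ≤ (component 𝒱₀ 𝒱₁ (d + n) m p).comap
    (LinearMap.mulLeft ℂ (even v : SuperSym V₀ V₁)) from this hx
  refine Submodule.span_le.mpr ?_
  rintro _ ⟨a, b, d', e, v', w, hv', hw, rfl, rfl, rfl, rfl⟩
  refine Submodule.subset_span ⟨a + 1, b, Fin.cons d d', e, Fin.cons v v', w,
    Fin.cases hv hv', hw, by simp [Fin.sum_univ_succ], rfl, rfl, ?_⟩
  simp only [prod_ι_succ_tmul, Fin.cons_zero, Fin.cons_succ, LinearMap.mulLeft_apply]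

theorem odd_mul_mem_component {e n m : ι →₀ ℕ} {p : ZMod 2} {w : V₁} {x : SuperSym V₀ V₁}
    (hw : w ∈ 𝒱₁ e) (hx : x ∈ component 𝒱₀ 𝒱₁ n m p) :
    odd w * x ∈ component 𝒱₀ 𝒱₁ n (e + m) (p + 1) := by
  suffices component 𝒱₀ 𝒱₁ n m p ≤ (component 𝒱₀ 𝒱₁ n (e + m) (p + 1)).comap
    (LinearMap.mulLeft ℂ (odd w : SuperSym V₀ V₁)) from this hx
  refine Submodule.span_le.mpr ?_
  rintro _ ⟨a, b, d, e', v, w', hv, hw', rfl, rfl, rfl, rfl⟩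
  refine Submodule.subset_span ⟨a, b + 1, d, Fin.cons e e', v, Fin.cons w w',
    hv, Fin.cases hw hw', rfl, by simp [Fin.sum_univ_succ], Nat.cast_succ b, ?_⟩
  simp only [tmul_ιMulti_succ, Fin.cons_zero, Fin.cons_succ, LinearMap.mulLeft_apply]

theorem component_le {W : (ι →₀ ℕ) → (ι →₀ ℕ) → ZMod 2 → Submodule ℂ (SuperSym V₀ V₁)}
    (one : 1 ∈ W 0 0 0)
    (even_mul : ∀ {d n m p v x}, v ∈ 𝒱₀ d → x ∈ component 𝒱₀ 𝒱₁ n m p → x ∈ W n m p →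
      even v * x ∈ W (d + n) m p)
    (odd_mul : ∀ {e n m p w x}, w ∈ 𝒱₁ e → x ∈ component 𝒱₀ 𝒱₁ n m p → x ∈ W n m p →
      odd w * x ∈ W n (e + m) (p + 1))
    (n m : ι →₀ ℕ) (p : ZMod 2) : component 𝒱₀ 𝒱₁ n m p ≤ W n m p := by
  refine Submodule.span_le.mpr ?_
  rintro _ ⟨a, b, d, e, v, w, hv, hw, rfl, rfl, rfl, rfl⟩
  induction a with
  | succ a ih =>
    rw [prod_ι_succ_tmul, Fin.sum_univ_succ]
    exact even_mul (hv 0)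
      (Submodule.subset_span ⟨a, b, _, e, _, w, fun r ↦ hv r.succ, hw, rfl, rfl, rfl, rfl⟩)
      (ih _ _ fun r ↦ hv r.succ)
  | zero =>
    induction b with
    | succ b ih =>
      rw [tmul_ιMulti_succ, Fin.sum_univ_succ, Nat.cast_succ]
      exact odd_mul (hw 0)
        (Submodule.subset_span ⟨0, b, d, _, v, _, hv, fun s ↦ hw s.succ, rfl, rfl, rfl, rfl⟩)
        (ih _ _ fun s ↦ hw s.succ)
    | zero => simpa [← Algebra.TensorProduct.one_def] using one

theorem map_mem_component {W₀ W₁ : Type*} [AddCommGroup W₀] [Module ℂ W₀] [AddCommGroup W₁]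
    [Module ℂ W₁] {𝒲₀ : (ι →₀ ℕ) → Submodule ℂ W₀} {𝒲₁ : (ι →₀ ℕ) → Submodule ℂ W₁}
    {f₀ : V₀ →ₗ[ℂ] W₀} {f₁ : V₁ →ₗ[ℂ] W₁} (h₀ : ∀ n, ∀ v ∈ 𝒱₀ n, f₀ v ∈ 𝒲₀ n)
    (h₁ : ∀ m, ∀ w ∈ 𝒱₁ m, f₁ w ∈ 𝒲₁ m) {n m : ι →₀ ℕ} {p : ZMod 2} {x : SuperSym V₀ V₁}
    (hx : x ∈ component 𝒱₀ 𝒱₁ n m p) : map f₀ f₁ x ∈ component 𝒲₀ 𝒲₁ n m p := by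
  refine component_le (𝒱₀ := 𝒱₀) (𝒱₁ := 𝒱₁)
    (W := fun n m p ↦ (component 𝒲₀ 𝒲₁ n m p).comap (map f₀ f₁).toLinearMap) ?_ ?_ ?_ n m p hx
  · simpa using one_mem_component
  · intro d n m p v x hv _ hx
    simpa [map_even] using even_mul_mem_component (h₀ d v hv) hx
  · intro e n m p w x hw _ hx
    simpa [map_odd] using odd_mul_mem_component (h₁ e w hw) hx

end component

section finiteDimensional

open Finset.HasAntidiagonal (antidiagonal mem_antidiagonal)

variable {ι V₀ V₁ : Type*} [AddCommGroup V₀] [Module ℂ V₀] [AddCommGroup V₁] [Module ℂ V₁]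
  {𝒱₀ : (ι →₀ ℕ) → Submodule ℂ V₀} {𝒱₁ : (ι →₀ ℕ) → Submodule ℂ V₁}

theorem component_le_sup [DecidableEq ι] (h₀ : 𝒱₀ 0 = ⊥) (h₁ : 𝒱₁ 0 = ⊥) (n m : ι →₀ ℕ)
    (p : ZMod 2) :
    component 𝒱₀ 𝒱₁ n m p ≤ (if n = 0 ∧ m = 0 ∧ p = 0 then 1 else ⊥) ⊔
      (⨆ d ∈ {d ∈ antidiagonal n | d.1 ≠ 0}, (𝒱₀ d.1).map even * component 𝒱₀ 𝒱₁ d.2 m p) ⊔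
      ⨆ e ∈ {e ∈ antidiagonal m | e.1 ≠ 0}, (𝒱₁ e.1).map odd * component 𝒱₀ 𝒱₁ n e.2 (p - 1) := by
  revert n m p
  refine component_le ?_ ?_ ?_
  · rw [if_pos ⟨rfl, rfl, rfl⟩]
    exact Submodule.mem_sup_left (Submodule.mem_sup_left (Submodule.one_le.mp le_rfl))
  · intro d n m p v x hv hx _
    obtain rfl | hd := eq_or_ne d 0
    · rw [h₀, Submodule.mem_bot] at hv
      rw [hv, map_zero, zero_mul]
      exact zero_mem _
    · refine Submodule.mem_sup_left (Submodule.mem_sup_right ?_)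
      refine Submodule.mem_iSup_of_mem (d, n) (Submodule.mem_iSup_of_mem ?_ ?_)
      · exact Finset.mem_filter.mpr ⟨mem_antidiagonal.mpr rfl, hd⟩
      · exact Submodule.mul_mem_mul (Submodule.mem_map_of_mem hv) hx
  · intro e n m p w x hw hx _
    obtain rfl | he := eq_or_ne e 0
    · rw [h₁, Submodule.mem_bot] at hw
      rw [hw, map_zero, zero_mul]
      exact zero_mem _
    · refine Submodule.mem_sup_right ?_
      refine Submodule.mem_iSup_of_mem (e, m) (Submodule.mem_iSup_of_mem ?_ ?_)
      · exact Finset.mem_filter.mpr ⟨mem_antidiagonal.mpr rfl, he⟩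
      · rw [add_sub_cancel_right]
        exact Submodule.mul_mem_mul (Submodule.mem_map_of_mem hw) hx

theorem finiteDimensional_component (h₀_fin : ∀ n, FiniteDimensional ℂ (𝒱₀ n))
    (h₁_fin : ∀ m, FiniteDimensional ℂ (𝒱₁ m)) (h₀ : 𝒱₀ 0 = ⊥) (h₁ : 𝒱₁ 0 = ⊥) (n m : ι →₀ ℕ)
    (p : ZMod 2) : FiniteDimensional ℂ (component 𝒱₀ 𝒱₁ n m p) := by
  classical
  induction hN : n.degree + m.degree using Nat.strong_induction_on generalizing n m p with
  | _ N ih =>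
  have degree_snd_lt {n : ι →₀ ℕ} {d : (ι →₀ ℕ) × (ι →₀ ℕ)}
      (hd : d ∈ {d ∈ antidiagonal n | d.1 ≠ 0}) : d.2.degree < n.degree := by
    rw [Finset.mem_filter, mem_antidiagonal] at hd
    have := (Finsupp.degree_eq_zero_iff d.1).not.mpr hd.2
    rw [← hd.1, map_add]
    omega
  have fg_even (d) (hd : d ∈ {d ∈ antidiagonal n | d.1 ≠ 0}) :
      ((𝒱₀ d.1).map even * component 𝒱₀ 𝒱₁ d.2 m p).FG :=
    (((𝒱₀ d.1).fg_iff_finiteDimensional.mpr (h₀_fin _)).map even).mul <|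
      (Submodule.fg_iff_finiteDimensional _).mpr <|
        ih _ (by have := degree_snd_lt hd; omega) _ _ _ rfl
  have fg_odd (e) (he : e ∈ {e ∈ antidiagonal m | e.1 ≠ 0}) :
      ((𝒱₁ e.1).map odd * component 𝒱₀ 𝒱₁ n e.2 (p - 1)).FG :=
    (((𝒱₁ e.1).fg_iff_finiteDimensional.mpr (h₁_fin _)).map odd).mul <|
      (Submodule.fg_iff_finiteDimensional _).mpr <|
        ih _ (by have := degree_snd_lt he; omega) _ _ _ rfl
  have fg_constants :
      (if n = 0 ∧ m = 0 ∧ p = 0 then 1 else ⊥ : Submodule ℂ (SuperSym V₀ V₁)).FG := by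
    split_ifs
    · rw [Submodule.one_eq_span]
      exact Submodule.fg_span_singleton 1
    · exact Submodule.fg_bot
  have := (Submodule.fg_iff_finiteDimensional _).mp <|
    (fg_constants.sup (Submodule.fg_biSup _ _ fg_even)).sup (Submodule.fg_biSup _ _ fg_odd)
  exact Submodule.finiteDimensional_of_le (component_le_sup h₀ h₁ n m p)

theorem component_zero_zero_zero (h₀ : 𝒱₀ 0 = ⊥) (h₁ : 𝒱₁ 0 = ⊥) : component 𝒱₀ 𝒱₁ 0 0 0 = 1 := by
  classical
  refine le_antisymm ((component_le_sup h₀ h₁ 0 0 0).trans ?_)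
    (Submodule.one_le.mpr one_mem_component)
  simp [Finset.filter_singleton]

theorem component_zero_zero_one (h₀ : 𝒱₀ 0 = ⊥) (h₁ : 𝒱₁ 0 = ⊥) : component 𝒱₀ 𝒱₁ 0 0 1 = ⊥ := by
  classical
  exact eq_bot_iff.mpr <| (component_le_sup h₀ h₁ 0 0 1).trans (by simp [Finset.filter_singleton])

end finiteDimensional

section independence

variable {ι V₀ V₁ : Type*} [AddCommGroup V₀] [Module ℂ V₀] [AddCommGroup V₁] [Module ℂ V₁]
  {𝒱₀ : (ι →₀ ℕ) → Submodule ℂ V₀} {𝒱₁ : (ι →₀ ℕ) → Submodule ℂ V₁}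

theorem component_le_eigenspace_map {f₀ : Module.End ℂ V₀} {f₁ : Module.End ℂ V₁}
    {c₀ c₁ : AddChar (ι →₀ ℕ) ℂ} (h₀ : ∀ n, 𝒱₀ n ≤ f₀.eigenspace (c₀ n))
    (h₁ : ∀ m, 𝒱₁ m ≤ f₁.eigenspace (c₁ m)) (n m : ι →₀ ℕ) (p : ZMod 2) :
    component 𝒱₀ 𝒱₁ n m p ≤ Module.End.eigenspace (map f₀ f₁).toLinearMap (c₀ n * c₁ m) := by
  simp only [SetLike.le_def, Module.End.mem_eigenspace_iff] at h₀ h₁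
  refine component_le (W := fun n m _ ↦ Module.End.eigenspace _ (c₀ n * c₁ m)) ?_ ?_ ?_ n m p
  · simp
  · intro d n m p v x hv _ hx
    rw [Module.End.mem_eigenspace_iff, AlgHom.toLinearMap_apply] at hx ⊢
    rw [map_mul, map_even, h₀ d hv, hx, map_smul, smul_mul_smul_comm, AddChar.map_add_eq_mul,
      mul_assoc]
  · intro e n m p w x hw _ hx
    rw [Module.End.mem_eigenspace_iff, AlgHom.toLinearMap_apply] at hx ⊢
    rw [map_mul, map_odd, h₁ e hw, hx, map_smul, smul_mul_smul_comm, AddChar.map_add_eq_mul,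
      mul_left_comm]

/-- The character `n ↦ 2 ^ n i` of the monoid of multidegrees; together these characters separate
multidegrees. -/
noncomputable def twoPowChar (i : ι) : AddChar (ι →₀ ℕ) ℂ where
  toFun n := 2 ^ n i
  map_zero_eq_one' := by simp
  map_add_eq_mul' n m := by simp [pow_add]

theorem iSupIndep_component (h₀ : iSupIndep 𝒱₀) (h₁ : iSupIndep 𝒱₁) (p : ZMod 2) :
    iSupIndep fun x : (ι →₀ ℕ) × (ι →₀ ℕ) ↦ component 𝒱₀ 𝒱₁ x.1 x.2 p := by
  choose f₀ hf₀ using fun i : ι ↦ exists_end_le_eigenspace h₀ (twoPowChar i)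
  choose f₁ hf₁ using fun i : ι ↦ exists_end_le_eigenspace h₁ (twoPowChar i)
  have two_pow_injective : Function.Injective fun k : ℕ ↦ (2 : ℂ) ^ k := by
    simpa [Function.comp_def] using
      (Nat.cast_injective (R := ℂ)).comp (Nat.pow_right_injective (le_refl 2))
  refine iSupIndep_of_le_eigenspace
    (T := Sum.elim (fun i ↦ (map (f₀ i) 1).toLinearMap) fun i ↦ (map 1 (f₁ i)).toLinearMap)
    (χ := fun x ↦ Sum.elim (fun i ↦ twoPowChar i x.1) fun i ↦ twoPowChar i x.2) ?_ ?_
  · intro x y hxy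
    exact Prod.ext (Finsupp.ext fun i ↦ two_pow_injective (congr_fun hxy (.inl i)))
      (Finsupp.ext fun i ↦ two_pow_injective (congr_fun hxy (.inr i)))
  · rintro x (i | i)
    · simpa using component_le_eigenspace_map (c₁ := 1) (hf₀ i) (fun m v _ ↦ by simp) x.1 x.2 p
    · simpa using component_le_eigenspace_map (c₀ := 1) (fun n v _ ↦ by simp) (hf₁ i) x.1 x.2 p

end independence

section totalComponent

variable {ι V₀ V₁ : Type*} [AddCommGroup V₀] [Module ℂ V₀] [AddCommGroup V₁] [Module ℂ V₁]

/-- The piece of `𝕂(V₀ ⊕ V₁)` of total multidegree `N` and parity `p`; after setting `t = u`, only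
this grading is visible in the index. -/
noncomputable def totalComponent (𝒱₀ : (ι →₀ ℕ) → Submodule ℂ V₀) (𝒱₁ : (ι →₀ ℕ) → Submodule ℂ V₁)
    (N : ι →₀ ℕ) (p : ZMod 2) : Submodule ℂ (SuperSym V₀ V₁) :=
  ⨆ x : {x : (ι →₀ ℕ) × (ι →₀ ℕ) // x.1 + x.2 = N}, component 𝒱₀ 𝒱₁ x.1.1 x.1.2 p

variable {𝒱₀ : (ι →₀ ℕ) → Submodule ℂ V₀} {𝒱₁ : (ι →₀ ℕ) → Submodule ℂ V₁}

theorem component_le_totalComponent {n m N : ι →₀ ℕ} (h : n + m = N) (p : ZMod 2) :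
    component 𝒱₀ 𝒱₁ n m p ≤ totalComponent 𝒱₀ 𝒱₁ N p :=
  le_iSup_of_le ⟨(n, m), h⟩ le_rfl

theorem even_mul_mem_totalComponent {d N : ι →₀ ℕ} {p : ZMod 2} {v : V₀} {x : SuperSym V₀ V₁}
    (hv : v ∈ 𝒱₀ d) (hx : x ∈ totalComponent 𝒱₀ 𝒱₁ N p) :
    even v * x ∈ totalComponent 𝒱₀ 𝒱₁ (d + N) p := by
  suffices totalComponent 𝒱₀ 𝒱₁ N p ≤ (totalComponent 𝒱₀ 𝒱₁ (d + N) p).comap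
    (LinearMap.mulLeft ℂ (even v : SuperSym V₀ V₁)) from this hx
  refine iSup_le ?_
  rintro ⟨⟨n, m⟩, rfl⟩ y hy
  exact component_le_totalComponent (add_assoc ..) p (even_mul_mem_component hv hy)

theorem odd_mul_mem_totalComponent {e N : ι →₀ ℕ} {p : ZMod 2} {w : V₁} {x : SuperSym V₀ V₁}
    (hw : w ∈ 𝒱₁ e) (hx : x ∈ totalComponent 𝒱₀ 𝒱₁ N p) :
    odd w * x ∈ totalComponent 𝒱₀ 𝒱₁ (e + N) (p + 1) := by
  suffices totalComponent 𝒱₀ 𝒱₁ N p ≤ (totalComponent 𝒱₀ 𝒱₁ (e + N) (p + 1)).comap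
    (LinearMap.mulLeft ℂ (odd w : SuperSym V₀ V₁)) from this hx
  refine iSup_le ?_
  rintro ⟨⟨n, m⟩, rfl⟩ y hy
  exact component_le_totalComponent (add_left_comm ..) (p + 1) (odd_mul_mem_component hw hy)

end totalComponent

section koszul

variable {ι V : Type*} [AddCommGroup V] [Module ℂ V] {𝒱 : (ι →₀ ℕ) → Submodule ℂ V}

theorem component_le_comap_koszul (n m : ι →₀ ℕ) (p : ZMod 2) :
    component 𝒱 𝒱 n m p ≤ (totalComponent 𝒱 𝒱 (n + m) (p + 1)).comap koszul := by
  refine component_le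
    (W := fun n m p ↦ (totalComponent 𝒱 𝒱 (n + m) (p + 1)).comap koszul) ?_ ?_ ?_ n m p
  · simp [koszul_one]
  · intro d n m p v x hv hx hDx
    rw [Submodule.mem_comap, koszul_even_mul, add_assoc]
    exact add_mem
      (component_le_totalComponent (add_left_comm ..) _ (odd_mul_mem_component hv hx))
      (even_mul_mem_totalComponent hv hDx)
  · intro e n m p w x hw hx hDx
    rw [Submodule.mem_comap, koszul_odd_mul, add_left_comm]
    have even_mul_mem : even w * x ∈ totalComponent 𝒱 𝒱 (e + (n + m)) (p + 1 + 1) := by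
      rw [add_assoc p, CharTwo.add_self_eq_zero, add_zero]
      exact component_le_totalComponent (add_assoc ..) p (even_mul_mem_component hw hx)
    exact sub_mem even_mul_mem (odd_mul_mem_totalComponent hw hDx)

theorem koszul_mem_totalComponent {N : ι →₀ ℕ} {p : ZMod 2} {x : SuperSym V V}
    (hx : x ∈ totalComponent 𝒱 𝒱 N p) : koszul x ∈ totalComponent 𝒱 𝒱 N (p + 1) := by
  suffices totalComponent 𝒱 𝒱 N p ≤ (totalComponent 𝒱 𝒱 N (p + 1)).comap koszul from this hx
  refine iSup_le ?_
  rintro ⟨⟨n, m⟩, rfl⟩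
  exact component_le_comap_koszul n m p

theorem even_mul_mem_eigenspace_koszul_sq {μ : ℂ} {x : SuperSym V V} (v : V)
    (hx : x ∈ Module.End.eigenspace (koszul ^ 2) μ) :
    even v * x ∈ Module.End.eigenspace (koszul ^ 2) (μ + 1) := by
  rw [Module.End.mem_eigenspace_iff, pow_two, Module.End.mul_apply] at hx ⊢
  rw [koszul_koszul_even_mul, hx, add_comm μ, add_smul, one_smul, mul_add, mul_smul_comm]

theorem odd_mul_mem_eigenspace_koszul_sq {μ : ℂ} {x : SuperSym V V} (w : V)
    (hx : x ∈ Module.End.eigenspace (koszul ^ 2) μ) :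
    odd w * x ∈ Module.End.eigenspace (koszul ^ 2) (μ + 1) := by
  rw [Module.End.mem_eigenspace_iff, pow_two, Module.End.mul_apply] at hx ⊢
  rw [koszul_koszul_odd_mul, hx, add_comm μ, add_smul, one_smul, mul_add, mul_smul_comm]

-- `D²` counts the factors of a product of generators, and only the empty product has degree zero.
theorem component_le_iSup_eigenspace_koszul_sq (n m : ι →₀ ℕ) (p : ZMod 2) :
    component 𝒱 𝒱 n m p ≤
      ⨆ k : {k : ℕ // k = 0 → n + m = 0}, Module.End.eigenspace (koszul ^ 2) (k : ℂ) := by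
  have succ_mem {n m n' m' : ι →₀ ℕ} {f : SuperSym V V →ₗ[ℂ] SuperSym V V}
      (hf : ∀ {μ x}, x ∈ Module.End.eigenspace (koszul ^ 2) μ →
        f x ∈ Module.End.eigenspace (koszul ^ 2) (μ + 1)) :
      ⨆ k : {k : ℕ // k = 0 → n + m = 0}, Module.End.eigenspace (koszul ^ 2) (k : ℂ) ≤
        (⨆ k : {k : ℕ // k = 0 → n' + m' = 0},
          Module.End.eigenspace (koszul ^ 2) (k : ℂ)).comap f :=
    iSup_le fun k x hx ↦ Submodule.mem_iSup_of_mem ⟨k + 1, fun h ↦ (Nat.succ_ne_zero _ h).elim⟩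
      (by simpa using hf hx)
  refine component_le (W := fun n m _ ↦ ⨆ k : {k : ℕ // k = 0 → n + m = 0},
    Module.End.eigenspace (koszul ^ 2) (k : ℂ)) ?_ ?_ ?_ n m p
  · exact Submodule.mem_iSup_of_mem ⟨0, fun _ ↦ add_zero 0⟩ (by simp [pow_two, koszul_one])
  · intro d n m p v x _ _ hx
    exact succ_mem (f := LinearMap.mulLeft ℂ (even v : SuperSym V V))
      (even_mul_mem_eigenspace_koszul_sq v) hx
  · intro e n m p w x _ _ hx
    exact succ_mem (f := LinearMap.mulLeft ℂ (odd w : SuperSym V V))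
      (odd_mul_mem_eigenspace_koszul_sq w) hx

theorem eq_zero_of_koszul_eq_zero {N : ι →₀ ℕ} (hN : N ≠ 0) {p : ZMod 2} {x : SuperSym V V}
    (hx : x ∈ totalComponent 𝒱 𝒱 N p) (hDx : koszul x = 0) : x = 0 := by
  have hx_zero : x ∈ Module.End.eigenspace (koszul ^ 2) (0 : ℂ) := by
    simp [pow_two, hDx]
  have hx_nonzero : x ∈ ⨆ μ ≠ (0 : ℂ), Module.End.eigenspace (koszul ^ 2) μ := by
    revert hx
    suffices totalComponent 𝒱 𝒱 N p ≤ ⨆ μ ≠ (0 : ℂ), Module.End.eigenspace (koszul ^ 2) μ from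
      fun hx ↦ this hx
    refine iSup_le ?_
    rintro ⟨⟨n, m⟩, rfl⟩
    refine (component_le_iSup_eigenspace_koszul_sq n m p).trans (iSup_le fun k ↦ ?_)
    exact le_iSup₂_of_le (k : ℂ) (Nat.cast_ne_zero.mpr (mt k.2 hN)) le_rfl
  exact Submodule.disjoint_def.mp (Module.End.eigenspaces_iSupIndep (koszul ^ 2) 0) x
    hx_zero hx_nonzero

end koszul

section invariants

variable {ι V L : Type*} [AddCommGroup V] [Module ℂ V] [Group L]
  {𝒱 : (ι →₀ ℕ) → Submodule ℂ V} {ρ : Representation ℂ L V}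

theorem act_eq_map (g : L) : act ρ g = map (ρ g) (ρ g) := rfl

theorem toSubmodule_invariants :
    Subalgebra.toSubmodule (invariants ρ) =
      ⨅ g, LinearMap.eqLocus (act ρ g).toLinearMap (1 : Module.End ℂ (SuperSym V V)) := by
  ext x
  simp [invariants, AlgHom.mem_equalizer]

theorem koszul_mem_invariants {x : SuperSym V V} (hx : x ∈ invariants ρ) :
    koszul x ∈ invariants ρ := by
  simp only [invariants, Algebra.mem_iInf, AlgHom.mem_equalizer, AlgHom.id_apply] at hx ⊢
  intro g
  rw [act_eq_map, ← koszul_map, ← act_eq_map, hx g]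

variable (𝒱 ρ) in
/-- The space of invariants of total multidegree `N` and parity `p`. -/
noncomputable def totalInvComponent (N : ι →₀ ℕ) (p : ZMod 2) : Submodule ℂ (SuperSym V V) :=
  totalComponent 𝒱 𝒱 N p ⊓ Subalgebra.toSubmodule (invariants ρ)

theorem totalInvComponent_eq_iSup (h_indep : iSupIndep 𝒱)
    (h_stable : ∀ g n, ∀ v ∈ 𝒱 n, ρ g v ∈ 𝒱 n) (N : ι →₀ ℕ) (p : ZMod 2) :
    totalInvComponent 𝒱 ρ N p =
      ⨆ x : {x : (ι →₀ ℕ) × (ι →₀ ℕ) // x.1 + x.2 = N}, invComponent 𝒱 ρ x.1.1 x.1.2 p := by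
  simp only [totalInvComponent, invComponent, toSubmodule_invariants]
  exact iSup_inf_eqLocus_of_iSupIndep
    ((iSupIndep_component h_indep h_indep p).comp Subtype.val_injective)
    fun g _ _ hx ↦ map_mem_component (h_stable g) (h_stable g) hx

theorem finiteDimensional_invComponent (h_fin : ∀ n, FiniteDimensional ℂ (𝒱 n)) (h_zero : 𝒱 0 = ⊥)
    (n m : ι →₀ ℕ) (p : ZMod 2) : FiniteDimensional ℂ (invComponent 𝒱 ρ n m p) :=
  have := finiteDimensional_component h_fin h_fin h_zero h_zero n m p
  Submodule.finiteDimensional_inf_left _ _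

theorem invComponent_zero_zero_zero (h_zero : 𝒱 0 = ⊥) : invComponent 𝒱 ρ 0 0 0 = 1 := by
  rw [invComponent, component_zero_zero_zero h_zero h_zero, inf_eq_left, Submodule.one_le]
  exact one_mem (invariants ρ)

theorem invComponent_zero_zero_one (h_zero : 𝒱 0 = ⊥) : invComponent 𝒱 ρ 0 0 1 = ⊥ := by
  rw [invComponent, component_zero_zero_one h_zero h_zero, bot_inf_eq]

section finrank

open Finset.HasAntidiagonal (antidiagonal mem_antidiagonal)

theorem finiteDimensional_totalInvComponent (h_fin : ∀ n, FiniteDimensional ℂ (𝒱 n))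
    (h_zero : 𝒱 0 = ⊥) (N : ι →₀ ℕ) (p : ZMod 2) :
    FiniteDimensional ℂ (totalInvComponent 𝒱 ρ N p) := by
  classical
  have := Fintype.subtype (antidiagonal N) fun _ ↦ mem_antidiagonal
  have := finiteDimensional_component h_fin h_fin h_zero h_zero
  have : FiniteDimensional ℂ (totalComponent 𝒱 𝒱 N p) := Submodule.finiteDimensional_iSup _
  exact Submodule.finiteDimensional_inf_left _ _

theorem finrank_totalInvComponent [DecidableEq ι] (h_indep : iSupIndep 𝒱)
    (h_fin : ∀ n, FiniteDimensional ℂ (𝒱 n)) (h_zero : 𝒱 0 = ⊥)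
    (h_stable : ∀ g n, ∀ v ∈ 𝒱 n, ρ g v ∈ 𝒱 n) (N : ι →₀ ℕ) (p : ZMod 2) :
    Module.finrank ℂ (totalInvComponent 𝒱 ρ N p) =
      ∑ x ∈ antidiagonal N, Module.finrank ℂ (invComponent 𝒱 ρ x.1 x.2 p) := by
  have := Fintype.subtype (antidiagonal N) fun _ ↦ mem_antidiagonal
  have := finiteDimensional_invComponent (ρ := ρ) h_fin h_zero
  rw [totalInvComponent_eq_iSup h_indep h_stable, finrank_iSup_of_iSupIndep]
  · exact (Finset.sum_subtype _ (fun _ ↦ mem_antidiagonal)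
      fun x ↦ Module.finrank ℂ (invComponent 𝒱 ρ x.1 x.2 p)).symm
  · exact ((iSupIndep_component h_indep h_indep p).comp Subtype.val_injective).mono
      fun _ ↦ inf_le_left

theorem finrank_totalInvComponent_le (h_fin : ∀ n, FiniteDimensional ℂ (𝒱 n))
    (h_zero : 𝒱 0 = ⊥) {N : ι →₀ ℕ} (hN : N ≠ 0) (p : ZMod 2) :
    Module.finrank ℂ (totalInvComponent 𝒱 ρ N p) ≤
      Module.finrank ℂ (totalInvComponent 𝒱 ρ N (p + 1)) := by
  have := finiteDimensional_totalInvComponent (ρ := ρ) h_fin h_zero N (p + 1)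
  refine LinearMap.finrank_le_finrank_of_injective (f := koszul.restrict fun x hx ↦
    ⟨koszul_mem_totalComponent hx.1, koszul_mem_invariants hx.2⟩) ?_
  refine (injective_iff_map_eq_zero _).mpr fun x hDx ↦ Subtype.ext ?_
  exact eq_zero_of_koszul_eq_zero hN x.2.1 (congrArg Subtype.val hDx)

theorem finrank_totalInvComponent_zero_eq_one (h_fin : ∀ n, FiniteDimensional ℂ (𝒱 n))
    (h_zero : 𝒱 0 = ⊥) {N : ι →₀ ℕ} (hN : N ≠ 0) :
    Module.finrank ℂ (totalInvComponent 𝒱 ρ N 0) =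
      Module.finrank ℂ (totalInvComponent 𝒱 ρ N 1) := by
  refine le_antisymm ?_ ?_
  · have h := finrank_totalInvComponent_le (ρ := ρ) h_fin h_zero hN 0
    rwa [zero_add] at h
  · have h := finrank_totalInvComponent_le (ρ := ρ) h_fin h_zero hN 1
    rwa [CharTwo.add_self_eq_zero] at h

theorem sum_finrank_invComponent_zero_eq_one [DecidableEq ι] (h_indep : iSupIndep 𝒱)
    (h_fin : ∀ n, FiniteDimensional ℂ (𝒱 n)) (h_zero : 𝒱 0 = ⊥)
    (h_stable : ∀ g n, ∀ v ∈ 𝒱 n, ρ g v ∈ 𝒱 n) {N : ι →₀ ℕ} (hN : N ≠ 0) :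
    ∑ x ∈ antidiagonal N, Module.finrank ℂ (invComponent 𝒱 ρ x.1 x.2 0) =
      ∑ x ∈ antidiagonal N, Module.finrank ℂ (invComponent 𝒱 ρ x.1 x.2 1) := by
  rw [← finrank_totalInvComponent h_indep h_fin h_zero h_stable,
    ← finrank_totalInvComponent h_indep h_fin h_zero h_stable,
    finrank_totalInvComponent_zero_eq_one h_fin h_zero hN]

end finrank

end invariants

end SuperSym

theorem coeff_identifyVars_superIndex {ι W : Type*} [DecidableEq ι] [AddCommGroup W] [Module ℂ W]
    (𝒲 : (ι →₀ ℕ) → (ι →₀ ℕ) → ZMod 2 → Submodule ℂ W) (N : ι →₀ ℕ) :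
    (identifyVars ι (superIndex 𝒲)).coeff N = ∑ x ∈ Finset.HasAntidiagonal.antidiagonal N,
      ((Module.finrank ℂ (𝒲 x.1 x.2 0) : ℤ) - Module.finrank ℂ (𝒲 x.1 x.2 1)) := by
  rw [identifyVars, MvPowerSeries.coeff_rename]
  refine Finset.sum_equiv Finsupp.sumFinsuppEquivProdFinsupp (fun c ↦ ?_) fun c _ ↦ rfl
  simp [mapDomain_sumElim_id]

theorem mainTheorem9_general {L ι V : Type*} [Group L] [AddCommGroup V] [Module ℂ V]
    (𝒱 : (ι →₀ ℕ) → Submodule ℂ V) (h_indep : iSupIndep 𝒱)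
    (h_fin : ∀ n, FiniteDimensional ℂ (𝒱 n)) (h_zero : 𝒱 0 = ⊥)
    (ρ : Representation ℂ L V) (h_stable : ∀ g n, ∀ v ∈ 𝒱 n, ρ g v ∈ 𝒱 n) :
    (∀ n m p, FiniteDimensional ℂ (SuperSym.invComponent 𝒱 ρ n m p)) ∧
      identifyVars ι (superIndex (SuperSym.invComponent 𝒱 ρ)) = 1 := by
  classical
  refine ⟨SuperSym.finiteDimensional_invComponent h_fin h_zero, MvPowerSeries.ext fun N ↦ ?_⟩
  rw [coeff_identifyVars_superIndex, MvPowerSeries.coeff_one]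
  split_ifs with hN
  · have finrank_constants :
        Module.finrank ℂ (1 : Submodule ℂ (SuperSym V V)) = 1 := by
      rw [Submodule.one_eq_span, finrank_span_singleton one_ne_zero]
    rw [hN, Finset.HasAntidiagonal.antidiagonal_zero, Finset.sum_singleton,
      SuperSym.invComponent_zero_zero_zero h_zero, SuperSym.invComponent_zero_zero_one h_zero,
      finrank_constants, finrank_bot, Nat.cast_one, Nat.cast_zero, sub_zero]
  · rw [Finset.sum_sub_distrib, ← Nat.cast_sum, ← Nat.cast_sum,
      SuperSym.sum_finrank_invComponent_zero_eq_one h_indep h_fin h_zero h_stable hN, sub_self]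

theorem mainTheorem9
    {E : Type*} [NormedAddCommGroup E] [NormedSpace ℝ E] [FiniteDimensional ℝ E]
    {H : Type*} [TopologicalSpace H] (I : ModelWithCorners ℝ E H) [I.Boundaryless]
    {L : Type*} [Group L] [TopologicalSpace L] [ChartedSpace H L] [LieGroup I ∞ L]
    [CompactSpace L] [T2Space L]
    {ι : Type*} [DecidableEq ι]
    {V : Type*} [AddCommGroup V] [Module ℂ V]
    (𝒱 : (ι →₀ ℕ) → Submodule ℂ V) (h_graded : DirectSum.IsInternal 𝒱)
    (h_fin : ∀ n, FiniteDimensional ℂ (𝒱 n)) (h_zero : 𝒱 0 = ⊥)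
    (ρ : Representation ℂ L V) (h_stable : ∀ g n, ∀ v ∈ 𝒱 n, ρ g v ∈ 𝒱 n)
    (h_cont : ∀ (φ : Module.Dual ℂ V) (v : V), Continuous fun g : L ↦ φ (ρ g v)) :
    (∀ n m p, FiniteDimensional ℂ (SuperSym.invComponent 𝒱 ρ n m p)) ∧
      identifyVars ι (superIndex (SuperSym.invComponent 𝒱 ρ)) = 1 :=
  mainTheorem9_general 𝒱 h_graded.submodule_iSupIndep h_fin h_zero ρ h_stable
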